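/- Let $$S_1=\begin{pmatrix}-1&1&1&1\\0&1&0&0\\0&0&1&0\\0&0&0&1\end{pmatrix},\quad S_2=\begin{pmatrix}1&0&0&0\\1&-1&1&1\\0&0&1&0\\0&0&0&1\end{pmatrix},\quad S_3=\begin{pmatrix}1&0&0&0\\0&1&0&0\\1&1&-1&1\\0&0&0&1\end{pmatrix},\quad S_4=\begin{pmatrix}1&0&0&0\\0&1&0&0\\0&0&1&0\\1&1&1&-1\end{pmatrix},$$ let the triangle group $T$ be the subgroup of $GL(4,\mathbb Z)$ generated by $S_1,S_2,S_3,S_4$, and let $$A=\begin{pmatrix}2&-1&-1&-1\\-1&2&-1&-1\\-1&-1&2&-1\\-1&-1&-1&2\end{pmatrix},\qquad Q(x)=x^{T}Ax\quad(x\in\mathbb R^4).$$ For a Coxeter matrix $(m_{ij})$ of rank $n$, let $\langle\cdot,\cdot\rangle$ be its canonical symmetric bilinear form on $\mathbb R^n$, given on the standard basis by $\langle\alpha_i,\alpha_j\rangle=-\cos(\pi/m_{ij})$ (and $-1$ if $m_{ij}=\infty$). The Coxeter group with Coxeter matrix $(m_{ij})$ is called hyperbolic if its Coxeter graph is connected,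 the canonical form has signature $(n-1,1)$, and $\langle x,x\rangle<0$ for every $x$ with $\langle\alpha_i,x\rangle>0$ for all $i$. Theorem. The triangle group $T$ with generators $S_1,S_2,S_3,S_4$ is a hyperbolic Coxeter group. More precisely, let $(m_{ij})$ be the Coxeter matrix of rank $4$ with $m_{ii}=1$ and $m_{ij}=3$ for $i\ne j$, and let $W=\langle s_1,\dots,s_4\mid s_i^2=1,\ (s_is_j)^3=1\ (i\neq j)\rangle$ be its Coxeter group. Then: 1. $S_i^2=I$ for all $i$ and $(S_iS_j)^3=I$ for all $i\ne j$. 2. These relations present $T$: there is an isomorphism $W\to T$ with $s_i\mapsto S_i$ for all $i$. 3. $A$ is the Cartan matrix of $(m_{ij})$, that is, $A_{ij}=-2\cos(\pi/m_{ij})=2\langle\alpha_i,\alpha_j\rangle$; moreover $Q(x)=3\sum_i x_i^2-\bigl(\sum_i x_i\bigr)^2$, and $Q(S_ix)=Q(x)$ for all $i$ and all $x\in\mathbb R^4$. 4. Each $S_i$ acts on $\mathbb R^4$ as the reflection $x\mapsto x-2\langle\alpha_i,x\rangle\alpha_i$, and the geometric representation of $W$ on $\mathbb R^4$, in which each $s_i$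 acts by this reflection, is faithful. 5. $Q$ has signature $(3,1)$, and the Coxeter group $W\cong T$ is hyperbolic. -/

import Mathlib

noncomputable section

/-- The four integer matrices `S₁, S₂, S₃, S₄` (indexed by `0, 1, 2, 3`). -/
def triangleMatrix : Fin 4 → Matrix (Fin 4) (Fin 4) ℤ :=
  ![!![-1, 1, 1, 1; 0, 1, 0, 0; 0, 0, 1, 0; 0, 0, 0, 1],
    !![1, 0, 0, 0; 1, -1, 1, 1; 0, 0, 1, 0; 0, 0, 0, 1],
    !![1, 0, 0, 0; 0, 1, 0, 0; 1, 1, -1, 1; 0, 0, 0, 1],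
    !![1, 0, 0, 0; 0, 1, 0, 0; 0, 0, 1, 0; 1, 1, 1, -1]]

theorem isUnit_det_triangleMatrix (i : Fin 4) : IsUnit (triangleMatrix i).det := by
  have h : (triangleMatrix i).det = -1 := by
    fin_cases i <;>
      simp [triangleMatrix, Matrix.det_succ_row_zero, Fin.sum_univ_succ, Fin.succAbove]
  rw [h]
  exact isUnit_one.neg

/-- The matrices `Sᵢ` as elements of `GL(4, ℤ)`. -/
def triangleGen (i : Fin 4) : GL (Fin 4) ℤ :=
  (triangleMatrix i).nonsingInvUnit (isUnit_det_triangleMatrix i)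

/-- The triangle group `T`: the subgroup of `GL(4, ℤ)` generated by `S₁, S₂, S₃, S₄`. -/
def triangleGroup : Subgroup (GL (Fin 4) ℤ) :=
  Subgroup.closure (Set.range triangleGen)

/-- The symmetric matrix `A` of the invariant quadratic form. -/
def triangleForm : Matrix (Fin 4) (Fin 4) ℤ :=
  !![2, -1, -1, -1; -1, 2, -1, -1; -1, -1, 2, -1; -1, -1, -1, 2]

/-- The real quadratic form `Q(x) = xᵀ A x`. -/
def triangleQuadraticForm : QuadraticForm ℝ (Fin 4 → ℝ) :=
  (triangleForm.map (Int.cast : ℤ → ℝ)).toQuadraticForm'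

/-- The Coxeter matrix on four generators with `m i j = 3` for all `i ≠ j`. -/
def triangleCoxeterMatrix : CoxeterMatrix (Fin 4) where
  M := Matrix.of fun i j => if i = j then 1 else 3
  isSymm := by unfold Matrix.IsSymm; aesop
  diagonal := by simp
  off_diagonal := by aesop

namespace CoxeterMatrix

variable {B : Type*} [Fintype B] [DecidableEq B] (M : CoxeterMatrix B)

/-- The canonical symmetric bilinear form of a Coxeter matrix, on the real vector space with basis
`(α i)`, given by `⟪α i, α j⟫ = -cos (π / m i j)`. An infinite order is encoded by `m i j = 0`,
and then `π / 0 = 0` in Lean gives the usual value `-1`. -/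
def canonicalForm : LinearMap.BilinForm ℝ (B → ℝ) :=
  Matrix.toBilin' (Matrix.of fun i j => -Real.cos (Real.pi / (M i j : ℝ)))

/-- The basis vector `α i`. -/
def simpleRoot {B : Type*} [DecidableEq B] (i : B) : B → ℝ := Pi.single i 1

/-- The reflection `x ↦ x - 2 ⟪α i, x⟫ α i`, by which the generator `s i` acts in the geometric
representation. -/
def geometricReflection (i : B) : Module.End ℝ (B → ℝ) :=
  LinearMap.id -
    (2 : ℝ) • (M.canonicalForm (simpleRoot i)).smulRight (simpleRoot i)

/-- The Coxeter graph: `i` and `j` are joined when `m i j ≥ 3` or `m i j` is infinite. -/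
def coxeterGraph : SimpleGraph B where
  Adj i j := i ≠ j ∧ M i j ≠ 2
  symm := ⟨fun i j h => ⟨h.1.symm, by rw [M.symmetric]; exact h.2⟩⟩
  loopless := ⟨fun i h => h.1 rfl⟩

/-- A Coxeter system of rank `n` is hyperbolic if it is irreducible, its canonical form has
signature `(n - 1, 1)`, and the form is negative on the open fundamental cone
`{x | ⟪α i, x⟫ > 0 for all i}`. -/
structure IsHyperbolic : Prop where
  irreducible : M.coxeterGraph.Connected
  sigPos_add_one : sigPos M.canonicalForm.toQuadraticMap + 1 = Fintype.card B
  sigNeg_eq_one : sigNeg M.canonicalForm.toQuadraticMap = 1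
  neg_on_cone : ∀ x : B → ℝ, (∀ i, 0 < M.canonicalForm (simpleRoot i) x) →
    M.canonicalForm x x < 0

end CoxeterMatrix

end

/-! Injectivity of `W → T` is the one deep point; the relations and the invariance of `Q` are matrix
computations. Over `ℝ`, each `Sᵢ` is the geometric reflection, so it suffices that the geometric
representation is faithful. This follows from positivity of roots: if `ℓ(w sᵢ) > ℓ(w)`, then `w αᵢ`
has nonnegative coordinates. Since all off-diagonal orders are `3`, the braid relation and induction
on length prove it (`apply_root_mem_of_not_isRightDescent`). The signature and hyperbolicity are
read off from `Q(x) = 3 ∑ xᵢ² - (∑ xᵢ)²`. -/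

namespace CoxeterSystem

variable {B W V : Type*} [Group W] {M : CoxeterMatrix B} (cs : CoxeterSystem M W)
  [AddCommGroup V] [Module ℝ V] {ρ : W →* Module.End ℝ V} {α : B → V}

/-- The braid relation `sᵢ sⱼ sᵢ = sⱼ sᵢ sⱼ` when `m i j = 3`. -/
theorem simple_braid {i j : B} (h : M i j = 3) :
    cs.simple i * cs.simple j * cs.simple i = cs.simple j * cs.simple i * cs.simple j := by
  have h3 := cs.simple_mul_simple_pow i j
  rw [h] at h3
  rw [← mul_inv_eq_one]
  simp only [mul_inv_rev, inv_simple]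
  simpa only [pow_succ, pow_zero, one_mul, mul_assoc] using h3

/-- If all off-diagonal orders are `3` and the generators act on the vectors `α i` as the simple
reflections, then `w` maps `α i` into the cone of the `α j` whenever `ℓ (w sᵢ) > ℓ w`. -/
theorem apply_root_mem_of_not_isRightDescent (hM : ∀ i j, i ≠ j → M i j = 3)
    (hself : ∀ i, ρ (cs.simple i) (α i) = -α i)
    (hne : ∀ i j, i ≠ j → ρ (cs.simple i) (α j) = α j + α i)
    {C : AddSubmonoid V} (hC : ∀ i, α i ∈ C) (w : W) (i : B)
    (hw : ¬ cs.IsRightDescent w i) : ρ w (α i) ∈ C := by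
  induction hn : cs.length w using Nat.strong_induction_on generalizing w i with
  | _ n ih =>
  by_cases h1 : w = 1
  · subst h1
    simpa using hC i
  obtain ⟨j, hj⟩ := cs.exists_rightDescent_of_ne_one h1
  have hij : i ≠ j := by
    rintro rfl
    exact hw hj
  obtain ⟨v, rfl⟩ : ∃ v, w = v * cs.simple j := ⟨w * cs.simple j, by simp⟩
  have hvj : ¬ cs.IsRightDescent v j := by
    simpa using cs.isRightDescent_iff_not_isRightDescent_mul.1 hj
  have hlv := cs.not_isRightDescent_iff.1 hvj
  have hvα : ρ v (α j) ∈ C := ih _ (by omega) v j hvj rfl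
  -- Here `w αᵢ = v αᵢ + v αⱼ`. If `i` is a descent of `v = u sᵢ`, the sum collapses to `u αⱼ`.
  by_cases hvi : cs.IsRightDescent v i
  · obtain ⟨u, rfl⟩ : ∃ u, v = u * cs.simple i := ⟨v * cs.simple i, by simp⟩
    have hlu : cs.length u + 1 = cs.length (u * cs.simple i) := by
      simpa using cs.isRightDescent_iff.1 hvi
    -- Otherwise `w sᵢ = u sᵢ sⱼ sᵢ = (u sⱼ) sᵢ sⱼ` has length at most `ℓ(u) + 1 < ℓ(w)`, making `i`
    -- a descent of `w`.
    have huj : ¬ cs.IsRightDescent u j := by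
      intro huj
      have hlx := cs.isRightDescent_iff.1 huj
      apply hw
      have hbraid : u * cs.simple i * cs.simple j * cs.simple i =
          u * cs.simple j * (cs.simple i * cs.simple j) := by
        simpa only [mul_assoc] using congrArg (u * ·) (cs.simple_braid (hM i j hij))
      have hle := cs.length_mul_le (u * cs.simple j) (cs.simple i * cs.simple j)
      have hle' := cs.length_mul_le (cs.simple i) (cs.simple j)
      rw [← hbraid] at hle
      simp only [length_simple] at hle'
      unfold IsRightDescent
      omega
    have huα : ρ u (α j) ∈ C := ih _ (by omega) u j huj rfl
    simpa [map_mul, hne j i hij.symm, hne i j hij, hself] using huα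
  · have hvα' : ρ v (α i) ∈ C := ih _ (by omega) v i hvi rfl
    simpa [map_mul, hne j i hij.symm] using add_mem hvα' hvα

/-- If all off-diagonal orders are `3`, a representation in which the generators act as the simple
reflections in roots lying in a pointed cone is faithful. -/
theorem injective_of_apply_root (hM : ∀ i j, i ≠ j → M i j = 3)
    (hself : ∀ i, ρ (cs.simple i) (α i) = -α i)
    (hne : ∀ i j, i ≠ j → ρ (cs.simple i) (α j) = α j + α i)
    {C : AddSubmonoid V} (hC : ∀ i, α i ∈ C) (hC' : ∀ i, -α i ∉ C) :
    Function.Injective ρ := by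
  refine (injective_iff_map_eq_one ρ).2 fun w hw => ?_
  by_contra h1
  obtain ⟨i, hi⟩ := cs.exists_rightDescent_of_ne_one h1
  -- As `w` acts trivially, `w sᵢ` sends `αᵢ` to `-αᵢ`, which lies outside the cone.
  have := cs.apply_root_mem_of_not_isRightDescent hM hself hne hC (w * cs.simple i) i
    (cs.isRightDescent_iff_not_isRightDescent_mul.1 hi)
  rw [map_mul, hw, one_mul, hself] at this
  exact hC' i this

end CoxeterSystem

/-! ### The matrices, the invariant form and the reflections -/

theorem triangleMatrix_sq (i : Fin 4) : triangleMatrix i ^ 2 = 1 := by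
  revert i
  unfold triangleMatrix
  decide +kernel

theorem triangleMatrix_mul_pow_three {i j : Fin 4} (h : i ≠ j) :
    (triangleMatrix i * triangleMatrix j) ^ 3 = 1 := by
  revert i j
  unfold triangleMatrix
  decide +kernel

theorem triangleCoxeterMatrix_apply (i j : Fin 4) :
    triangleCoxeterMatrix i j = if i = j then 1 else 3 := rfl

theorem triangleForm_apply (i j : Fin 4) : triangleForm i j = if i = j then 2 else -1 := by
  fin_cases i <;> fin_cases j <;> rfl

theorem triangleForm_eq_neg_two_mul_cos (i j : Fin 4) : (triangleForm i j : ℝ) =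
    -2 * Real.cos (Real.pi / (triangleCoxeterMatrix i j : ℝ)) := by
  rw [triangleForm_apply, triangleCoxeterMatrix_apply]
  split_ifs <;> norm_num

theorem triangleQuadraticForm_apply (x : Fin 4 → ℝ) :
    triangleQuadraticForm x = 3 * ∑ i, x i ^ 2 - (∑ i, x i) ^ 2 := by
  simp [triangleQuadraticForm, Matrix.toQuadraticForm', Matrix.toLinearMap₂'_apply,
    LinearMap.BilinMap.toQuadraticMap_apply, triangleForm_apply, Fin.sum_univ_four]
  ring

theorem triangleCoxeterMatrix_canonicalForm_apply (x y : Fin 4 → ℝ) :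
    triangleCoxeterMatrix.canonicalForm x y =
      (3 * ∑ i, x i * y i - (∑ i, x i) * ∑ i, y i) / 2 := by
  have h (i j : Fin 4) : -Real.cos (Real.pi / (triangleCoxeterMatrix i j : ℝ)) =
      (triangleForm i j : ℝ) / 2 := by
    rw [triangleForm_eq_neg_two_mul_cos]
    ring
  simp only [CoxeterMatrix.canonicalForm, h, Matrix.toBilin'_apply, triangleForm_apply]
  simp [Fin.sum_univ_four]
  ring

theorem triangleCoxeterMatrix_canonicalForm_simpleRoot (i : Fin 4) (x : Fin 4 → ℝ) :
    triangleCoxeterMatrix.canonicalForm (CoxeterMatrix.simpleRoot i) x =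
      (3 * x i - ∑ i, x i) / 2 := by
  simp [triangleCoxeterMatrix_canonicalForm_apply, CoxeterMatrix.simpleRoot, Pi.single_apply]

theorem geometricReflection_apply (i : Fin 4) (x : Fin 4 → ℝ) :
    triangleCoxeterMatrix.geometricReflection i x =
      x - (3 * x i - ∑ i, x i) • CoxeterMatrix.simpleRoot i := by
  simp only [CoxeterMatrix.geometricReflection, LinearMap.sub_apply, LinearMap.id_apply,
    LinearMap.smul_apply, LinearMap.smulRight_apply, smul_smul,
    triangleCoxeterMatrix_canonicalForm_simpleRoot]
  congr 2
  ring

theorem toLin'_triangleMatrix (i : Fin 4) :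
    Matrix.toLin' ((triangleMatrix i).map (Int.cast : ℤ → ℝ)) =
      triangleCoxeterMatrix.geometricReflection i := by
  refine LinearMap.ext fun x => ?_
  rw [geometricReflection_apply]
  ext k
  fin_cases i <;> fin_cases k <;>
    simp [triangleMatrix, Matrix.mulVec, dotProduct, Fin.sum_univ_four,
      CoxeterMatrix.simpleRoot] <;> ring

theorem triangleQuadraticForm_mulVec (i : Fin 4) (x : Fin 4 → ℝ) : triangleQuadraticForm
    (((triangleMatrix i).map (Int.cast : ℤ → ℝ)).mulVec x) = triangleQuadraticForm x := by
  rw [← Matrix.toLin'_apply, toLin'_triangleMatrix, geometricReflection_apply,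
    triangleQuadraticForm_apply, triangleQuadraticForm_apply]
  fin_cases i <;>
    simp [Fin.sum_univ_four, CoxeterMatrix.simpleRoot, Pi.single_apply] <;> ring

/-! ### Faithfulness and the presentation of `T` -/

/-- The homomorphism from the abstract Coxeter group to `GL(4, ℤ)` with `sᵢ ↦ Sᵢ`. -/
noncomputable def triangleHom : triangleCoxeterMatrix.Group →* GL (Fin 4) ℤ :=
  triangleCoxeterMatrix.toCoxeterSystem.lift ⟨triangleGen, fun i j => Units.ext <| by
    rw [triangleCoxeterMatrix_apply]
    split_ifs with h
    · subst h
      rw [pow_one, ← sq]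
      exact triangleMatrix_sq i
    · exact triangleMatrix_mul_pow_three h⟩

theorem triangleHom_simple (i : Fin 4) :
    triangleHom (triangleCoxeterMatrix.simple i) = triangleGen i := by
  rw [← CoxeterMatrix.toCoxeterSystem_simple]
  exact triangleCoxeterMatrix.toCoxeterSystem.lift_apply_simple _ i

/-- The geometric representation of the abstract Coxeter group, through `GL(4, ℤ)`. -/
noncomputable def triangleRepresentation :
    Representation ℝ triangleCoxeterMatrix.Group (Fin 4 → ℝ) :=
  ((Matrix.toLinAlgEquiv' : Matrix (Fin 4) (Fin 4) ℝ ≃ₐ[ℝ] _).toMonoidHom.comp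
    ((Int.castRingHom ℝ).mapMatrix : Matrix (Fin 4) (Fin 4) ℤ →+* _).toMonoidHom).comp
    ((Units.coeHom _).comp triangleHom)

theorem triangleRepresentation_simple (i : Fin 4) :
    triangleRepresentation (triangleCoxeterMatrix.simple i) =
      triangleCoxeterMatrix.geometricReflection i := by
  rw [← toLin'_triangleMatrix]
  change Matrix.toLinAlgEquiv' ((Int.castRingHom ℝ).mapMatrix
    (triangleHom (triangleCoxeterMatrix.simple i) : Matrix (Fin 4) (Fin 4) ℤ)) = _
  rw [triangleHom_simple]
  rfl

theorem triangleRepresentation_injective : Function.Injective triangleRepresentation := by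
  refine triangleCoxeterMatrix.toCoxeterSystem.injective_of_apply_root
    (α := CoxeterMatrix.simpleRoot) (C := AddSubmonoid.nonneg (Fin 4 → ℝ))
    (fun i j h => by simp [triangleCoxeterMatrix_apply, h]) (fun i => ?_) (fun i j h => ?_)
    (fun i => ?_) (fun i hi => ?_)
  · rw [CoxeterMatrix.toCoxeterSystem_simple, triangleRepresentation_simple,
      geometricReflection_apply]
    ext k
    simp [CoxeterMatrix.simpleRoot]
    ring
  · rw [CoxeterMatrix.toCoxeterSystem_simple, triangleRepresentation_simple,
      geometricReflection_apply]
    ext k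
    simp [CoxeterMatrix.simpleRoot, h]
  · simp [CoxeterMatrix.simpleRoot]
  · have := (AddSubmonoid.mem_nonneg.1 hi) i
    norm_num [CoxeterMatrix.simpleRoot] at this

/-- The faithful geometric representation factors through `triangleHom`. -/
theorem triangleHom_injective : Function.Injective triangleHom := by
  intro v w h
  apply triangleRepresentation_injective
  simp only [triangleRepresentation, MonoidHom.comp_apply, h]

theorem triangleHom_range : triangleHom.range = triangleGroup := by
  rw [MonoidHom.range_eq_map,
    ← triangleCoxeterMatrix.toCoxeterSystem.subgroup_closure_range_simple,
    MonoidHom.map_closure, ← Set.range_comp, triangleGroup]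
  congr 2
  exact funext triangleHom_simple

theorem exists_coxeterSystem_triangleGroup :
    ∃ cs : CoxeterSystem triangleCoxeterMatrix triangleGroup,
      ∀ i, (cs.simple i : GL (Fin 4) ℤ) = triangleGen i := by
  refine ⟨triangleCoxeterMatrix.toCoxeterSystem.map
    ((MonoidHom.ofInjective triangleHom_injective).trans
      (MulEquiv.subgroupCongr triangleHom_range)), fun i => ?_⟩
  simp [triangleHom_simple, MonoidHom.ofInjective_apply]

/-! ### Signature and hyperbolicity -/

/-- The signature of a positive multiple of `3 ∑ xᵢ² - (∑ xᵢ)²` on `ℝ⁴` is `(3, 1)`. -/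
theorem sigPos_eq_three_and_sigNeg_eq_one {Q : QuadraticForm ℝ (Fin 4 → ℝ)} {c : ℝ} (hc : 0 < c)
    (hQ : ∀ x, Q x = c * (3 * ∑ i, x i ^ 2 - (∑ i, x i) ^ 2)) : sigPos Q = 3 ∧ sigNeg Q = 1 := by
  have hsum := QuadraticForm.sigPos_add_sigNeg_add_radical (Q := Q)
  rw [Module.finrank_fin_fun] at hsum
  -- On the hyperplane `∑ xᵢ = 0`, `Q` is `3c ∑ xᵢ²`.
  have hpos : 3 ≤ sigPos Q := by
    let f : (Fin 4 → ℝ) →ₗ[ℝ] ℝ := ∑ i, LinearMap.proj i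
    have hf (x : Fin 4 → ℝ) : f x = ∑ i, x i := by simp [f]
    have hsurj : Function.Surjective f := fun t => ⟨Pi.single 0 t, by simp [hf]⟩
    have hker := LinearMap.finrank_range_add_finrank_ker f
    rw [LinearMap.range_eq_top.2 hsurj, finrank_top, Module.finrank_self,
      Module.finrank_fin_fun] at hker
    have hle : Module.finrank ℝ f.ker ≤ sigPos Q := by
      refine le_sigPos_of_posDef Q fun x hx => ?_
      have hx0 : ∑ i, x.1 i = 0 := by simpa only [hf] using LinearMap.mem_ker.1 x.2
      rw [QuadraticMap.restrict_apply, hQ, hx0]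
      have hne : x.1 ≠ 0 := by simpa using hx
      obtain ⟨i, hi⟩ := Function.ne_iff.1 hne
      have : 0 < ∑ i, x.1 i ^ 2 :=
        Finset.sum_pos' (fun _ _ => sq_nonneg _) ⟨i, Finset.mem_univ i, sq_pos_of_ne_zero hi⟩
      norm_num
      positivity
    omega
  -- On the line through `(1, 1, 1, 1)`, `Q` takes the values `c (12 - 16) t² = -4c t²`.
  have hneg : 1 ≤ sigNeg Q := by
    rw [← finrank_span_singleton (K := ℝ) (v := (1 : Fin 4 → ℝ)) one_ne_zero]
    refine le_sigNeg_of_negDef Q fun x hx => ?_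
    obtain ⟨t, ht⟩ := Submodule.mem_span_singleton.1 x.2
    have ht0 : t ≠ 0 := by
      rintro rfl
      exact hx (Subtype.ext (by simpa using ht.symm))
    rw [QuadraticMap.restrict_apply, neg_apply, hQ, ← ht]
    have : 0 < t ^ 2 := by positivity
    simp
    nlinarith [mul_pos hc this]
  omega

theorem triangleCoxeterMatrix_isHyperbolic : triangleCoxeterMatrix.IsHyperbolic := by
  have hsig := sigPos_eq_three_and_sigNeg_eq_one
    (Q := triangleCoxeterMatrix.canonicalForm.toQuadraticMap) (c := 1 / 2) (by norm_num)
    fun x => by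
      rw [LinearMap.BilinMap.toQuadraticMap_apply, triangleCoxeterMatrix_canonicalForm_apply]
      simp only [sq]
      ring
  refine ⟨?_, by simp [hsig.1], hsig.2, fun x hx => ?_⟩
  · have htop : triangleCoxeterMatrix.coxeterGraph = ⊤ := by
      ext i j
      simp only [CoxeterMatrix.coxeterGraph, triangleCoxeterMatrix_apply, SimpleGraph.top_adj]
      split_ifs <;> simp_all
    rw [htop]
    exact SimpleGraph.connected_top
  · simp only [triangleCoxeterMatrix_canonicalForm_simpleRoot] at hx
    -- Put `yᵢ = 3 xᵢ - ∑ xₖ > 0`. Then `∑ yⱼ = -∑ xₖ`, so `yᵢ < ∑ yⱼ` says `xᵢ < 0`. The sum here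
    -- is `2 ⟪x, x⟫`.
    have hlt : ∑ i, x i * (3 * x i - ∑ k, x k) < 0 := by
      refine Finset.sum_neg (fun i _ => mul_neg_of_neg_of_pos ?_ (by linarith [hx i]))
        Finset.univ_nonempty
      have hsingle : 3 * x i - ∑ k, x k < ∑ j, (3 * x j - ∑ k, x k) :=
        -- Any index other than `i` gives strictness; `i + 1` is taken modulo `4`.
        Finset.single_lt_sum (f := fun j => 3 * x j - ∑ k, x k) (i := i) (j := i + 1) (by simp)
          (Finset.mem_univ _) (Finset.mem_univ _)
          (by linarith [hx (i + 1)]) fun j _ _ => by linarith [hx j]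
      simp only [Finset.sum_sub_distrib, ← Finset.mul_sum, Finset.sum_const, Finset.card_univ,
        Fintype.card_fin, nsmul_eq_mul] at hsingle
      push_cast at hsingle
      linarith
    rw [triangleCoxeterMatrix_canonicalForm_apply]
    simp only [mul_sub, Finset.sum_sub_distrib, ← Finset.sum_mul] at hlt
    simp only [mul_left_comm _ (3 : ℝ), ← Finset.mul_sum] at hlt
    linarith

theorem mainTheorem1 :
    -- the Coxeter relations hold for the matrices
    (∀ i, triangleMatrix i ^ 2 = 1) ∧
    (∀ i j, i ≠ j → (triangleMatrix i * triangleMatrix j) ^ 3 = 1) ∧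
    -- these relations present the triangle group: it is a Coxeter group with simple
    -- reflections `Sᵢ` and all off-diagonal orders equal to 3
    (∃ cs : CoxeterSystem triangleCoxeterMatrix triangleGroup,
      ∀ i, (cs.simple i : GL (Fin 4) ℤ) = triangleGen i) ∧
    -- `A` is the Cartan matrix of this Coxeter matrix, its quadratic form is
    -- `3 ∑ xᵢ² - (∑ xᵢ)²`, and it is invariant under the `Sᵢ`
    (∀ i j, (triangleForm i j : ℝ) =
      -2 * Real.cos (Real.pi / (triangleCoxeterMatrix i j : ℝ))) ∧
    (∀ x : Fin 4 → ℝ, triangleQuadraticForm x = 3 * ∑ i, x i ^ 2 - (∑ i, x i) ^ 2) ∧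
    (∀ i, ∀ x : Fin 4 → ℝ, triangleQuadraticForm
      (((triangleMatrix i).map (Int.cast : ℤ → ℝ)).mulVec x) = triangleQuadraticForm x) ∧
    -- `Sᵢ` is the reflection in the `i`-th simple root, so that the matrices give the
    -- geometric representation of the abstract Coxeter group, which is faithful
    (∀ i, Matrix.toLin' ((triangleMatrix i).map (Int.cast : ℤ → ℝ)) =
      triangleCoxeterMatrix.geometricReflection i) ∧
    (∃ ρ : Representation ℝ triangleCoxeterMatrix.Group (Fin 4 → ℝ),
      (∀ i, ρ (triangleCoxeterMatrix.simple i) =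
        triangleCoxeterMatrix.geometricReflection i) ∧
      Function.Injective ρ) ∧
    -- the form has signature `(3, 1)`, and the Coxeter group is hyperbolic
    sigPos triangleQuadraticForm = 3 ∧
    sigNeg triangleQuadraticForm = 1 ∧
    triangleCoxeterMatrix.IsHyperbolic := by
  have hsig := sigPos_eq_three_and_sigNeg_eq_one (Q := triangleQuadraticForm) one_pos fun x => by
    rw [triangleQuadraticForm_apply, one_mul]
  exact ⟨triangleMatrix_sq, fun _ _ => triangleMatrix_mul_pow_three,
    exists_coxeterSystem_triangleGroup, triangleForm_eq_neg_two_mul_cos,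
    triangleQuadraticForm_apply, triangleQuadraticForm_mulVec, toLin'_triangleMatrix,
    ⟨triangleRepresentation, triangleRepresentation_simple, triangleRepresentation_injective⟩,
    hsig.1, hsig.2, triangleCoxeterMatrix_isHyperbolic⟩
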